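/- Let $G$ be a finite group. A $G$-Tambara functor $T$ consists of a commutative ring $T(G/H)$ for each subgroup $H\le G$, together with, for $K\le H\le G$ and $g\in G$, a restriction ring homomorphism $r^H_K\colon T(G/H)\to T(G/K)$, an additive transfer $t^H_K\colon T(G/K)\to T(G/H)$, a multiplicative (and unit-preserving) norm $N^H_K\colon T(G/K)\to T(G/H)$, and a conjugation ring isomorphism $c_{g,H}\colon T(G/H)\to T(G/gHg^{-1})$. These satisfy functoriality (including $r^H_H=t^H_H=N^H_H=\mathrm{id}$ and $c_{h,H}=\mathrm{id}$ for $h\in H$), compatibility of $r,t,N$ with conjugation, the additive and multiplicative double coset formulas, Frobenius reciprocity, and Tambara reciprocity: for $H\le K$ and $a,b\in T(G/H)$, $$N^K_H(a+b)=\sum_{[f]}t^K_{S_f}\Bigl(\prod_{[\gamma]\in S_f\backslash K/H}N^{S_f}_{S_f\cap\gamma H\gamma^{-1}}\,r^{\gamma H\gamma^{-1}}_{S_f\cap\gamma H\gamma^{-1}}\,c_{\gamma,H}\bigl(f(\gamma H)\bigr)\Bigr),$$ where $[f]$ runs over the $K$-orbits of maps $f$ from $K/H$ to the two formal labels $a,b$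 and $S_f\le K$ is the stabilizer of $f$; and for $L\le H\le K$ and $a\in T(G/L)$, $$N^K_H(t^H_L(a))=\sum_{[s]}t^K_{S_s}\Bigl(\prod_{[\gamma]\in S_s\backslash K/H}N^{S_s}_{S_s\cap\gamma L\gamma^{-1}}\,r^{\gamma L\gamma^{-1}}_{S_s\cap\gamma L\gamma^{-1}}\,c_{\gamma,L}(a)\Bigr),$$ where $[s]$ runs over the $K$-orbits of sections $s$ of $K/L\to K/H$, $S_s\le K$ is the stabilizer of $s$, and the representatives $\gamma$ are chosen so that $s(\gamma H)=\gamma L$. A Tambara ideal $I$ of $T$ is a family of ideals $I(G/H)\subseteq T(G/H)$ closed under restrictions, transfers and norms and with $c_g(I(G/H))=I(G/gHg^{-1})$; inclusion of Tambara ideals is levelwise. The product $IJ$ is the Tambara ideal generated by the levelwise products $I(G/H)J(G/H)$. A Tambara ideal $P$ is prime if $1\notin P(G/G)$ and, for all Tambara ideals $I,J$, $IJ\subseteq P$ implies $I\subseteq P$ or $J\subseteq P$. The radical of $I$ is given by $(\sqrt I)(G/H)=\{x\in T(G/H)\mid \langle x\rangle^n\subseteq I\text{ for some }n\ge 1\}$,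 where $\langle x\rangle$ is the Tambara ideal generated by $x$, and $I$ is radical if $I=\sqrt I$. The Nakaoka spectrum $\mathrm{Spec}_{\mathbf{Nak}}(T)$ is the set of prime Tambara ideals with the topology for which the sets $V_H(x)=\{P\mid x\in P(G/H)\}$, $H\le G$, $x\in T(G/H)$, form a subbasis of closed sets. **Corollary.** Let $G$ be a finite group and $T$ a $G$-Tambara functor. The set $\mathrm{RadId}_G(T)$ of radical Tambara ideals of $T$, ordered by inclusion, is a frame, and there is an isomorphism of frames $$\mathrm{RadId}_G(T)\;\cong\;\Omega(\mathrm{Spec}_{\mathbf{Nak}}(T))$$ onto the frame of open subsets of the Nakaoka spectrum, given by $I\mapsto\{P\in\mathrm{Spec}_{\mathbf{Nak}}(T)\mid I\not\subseteq P\}$. -/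

import Mathlib

open CategoryTheory

universe u v

section Subgroups

variable {G : Type u} [Group G]

/-- The conjugate subgroup `g H g⁻¹`. -/
abbrev conjSubgroup (g : G) (H : Subgroup G) : Subgroup G :=
  H.map (MulAut.conj g).toMonoidHom

/-- The finite set `K / H` of left cosets, for `H ≤ K ≤ G` (with its left `K`-action). -/
abbrev CosetsIn (K H : Subgroup G) : Type u := K ⧸ H.subgroupOf K

/-- `R` is a set of representatives, one for each double coset in `L \ K / H`. -/
def IsDoubleCosetReps (L K H : Subgroup G) (R : Finset K) : Prop :=
  ∀ k : K, ∃! γ : K, γ ∈ R ∧ ∃ l ∈ L, ∃ h ∈ H, (γ : G) = l * k * h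

/-- The group `K` acts on the two-valued functions on `K / H` by `(k f)(x) = f (k⁻¹ x)`.
This is the stabilizer of `f` in `K`, as a subgroup of `G`. -/
def colouringStab {K H : Subgroup G} (f : CosetsIn K H → Bool) : Subgroup G where
  carrier := {g | ∃ hg : g ∈ K, ∀ x, f ((⟨g, hg⟩ : K) • x) = f x}
  one_mem' := ⟨K.one_mem, fun x => congrArg f (one_smul K x)⟩
  mul_mem' := by
    rintro a b ⟨ha, ha'⟩ ⟨hb, hb'⟩
    refine ⟨K.mul_mem ha hb, fun x => ?_⟩
    rw [← hb' x, ← ha' ((⟨b, hb⟩ : K) • x), smul_smul]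
    rfl
  inv_mem' := by
    rintro a ⟨ha, ha'⟩
    refine ⟨K.inv_mem ha, fun x => ?_⟩
    rw [← ha' ((⟨a⁻¹, K.inv_mem ha⟩ : K) • x), smul_smul]
    congr 1
    exact (congrArg (· • x) (mul_inv_cancel (⟨a, ha⟩ : K))).trans (one_smul K x)

lemma colouringStab_le {K H : Subgroup G} (f : CosetsIn K H → Bool) : colouringStab f ≤ K :=
  fun _ hg => hg.1

/-- `F` is a set of representatives, one for each `K`-orbit of two-valued functions on `K / H`. -/
def IsColouringReps {K H : Subgroup G} (F : Finset (CosetsIn K H → Bool)) : Prop :=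
  ∀ f : CosetsIn K H → Bool, ∃! f', f' ∈ F ∧ ∃ k : K, ∀ x, f' x = f (k⁻¹ • x)

/-- `s` is a section of the projection `K / L → K / H`, for `L ≤ H ≤ K`. -/
def IsCosetSection {L H K : Subgroup G} (hL : L ≤ H) (s : CosetsIn K H → CosetsIn K L) : Prop :=
  ∀ x, Subgroup.quotientMapOfLE (Subgroup.comap_mono hL) (s x) = x

/-- The group `K` acts on the maps `K / H → K / L` by `(k s)(x) = k (s (k⁻¹ x))`.
This is the stabilizer of `s` in `K`, as a subgroup of `G`. -/
def sectionStab {L H K : Subgroup G} (s : CosetsIn K H → CosetsIn K L) : Subgroup G where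
  carrier := {g | ∃ hg : g ∈ K, ∀ x, s ((⟨g, hg⟩ : K) • x) = (⟨g, hg⟩ : K) • s x}
  one_mem' := ⟨K.one_mem, fun x => (congrArg s (one_smul K x)).trans (one_smul K (s x)).symm⟩
  mul_mem' := by
    rintro a b ⟨ha, ha'⟩ ⟨hb, hb'⟩
    refine ⟨K.mul_mem ha hb, fun x => ?_⟩
    have h : (⟨a * b, K.mul_mem ha hb⟩ : K) = ⟨a, ha⟩ * ⟨b, hb⟩ := rfl
    rw [h, mul_smul, mul_smul, ha', hb']
  inv_mem' := by
    rintro a ⟨ha, ha'⟩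
    refine ⟨K.inv_mem ha, fun x => ?_⟩
    have h : (⟨a⁻¹, K.inv_mem ha⟩ : K) = (⟨a, ha⟩ : K)⁻¹ := rfl
    rw [h, eq_inv_smul_iff, ← ha', smul_inv_smul]

lemma sectionStab_le {L H K : Subgroup G} (s : CosetsIn K H → CosetsIn K L) :
    sectionStab s ≤ K :=
  fun _ hg => hg.1

/-- `F` is a set of representatives, one for each `K`-orbit of sections of `K / L → K / H`. -/
def IsSectionReps {L H K : Subgroup G} (hL : L ≤ H)
    (F : Finset (CosetsIn K H → CosetsIn K L)) : Prop :=
  (∀ s ∈ F, IsCosetSection hL s) ∧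
    ∀ s, IsCosetSection hL s → ∃! s', s' ∈ F ∧ ∃ k : K, ∀ x, s' x = k • s (k⁻¹ • x)

end Subgroups

/-- A `G`-Tambara functor, presented by its values `obj H = T(G/H)` on the transitive `G`-sets.

The conjugation `T(G/H) → T(G/gHg⁻¹)` is indexed by a subgroup `H'` with a proof of
`gHg⁻¹ = H'`, so that composites of conjugations can be compared without transports.
Formulas indexed by (double) cosets or by orbits hold for every choice of representatives. -/
structure TambaraFunctor (G : Type u) [Group G] where
  obj : Subgroup G → Type v
  [ring : ∀ H, CommRing (obj H)]
  /-- restriction `r^H_K` -/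
  res : ∀ {K H : Subgroup G}, K ≤ H → (obj H →+* obj K)
  /-- transfer `t^H_K` -/
  tr : ∀ {K H : Subgroup G}, K ≤ H → (obj K →+ obj H)
  /-- norm `N^H_K` -/
  nm : ∀ {K H : Subgroup G}, K ≤ H → (obj K →* obj H)
  /-- conjugation `c_{g,H}` -/
  conj : ∀ (g : G) {H H' : Subgroup G}, conjSubgroup g H = H' → (obj H ≃+* obj H')
  -- functoriality
  res_refl : ∀ {H : Subgroup G} (x : obj H), res (le_refl H) x = x
  tr_refl : ∀ {H : Subgroup G} (x : obj H), tr (le_refl H) x = x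
  nm_refl : ∀ {H : Subgroup G} (x : obj H), nm (le_refl H) x = x
  res_res : ∀ {L K H : Subgroup G} (hL : L ≤ K) (hK : K ≤ H) (x : obj H),
    res hL (res hK x) = res (hL.trans hK) x
  tr_tr : ∀ {L K H : Subgroup G} (hL : L ≤ K) (hK : K ≤ H) (x : obj L),
    tr hK (tr hL x) = tr (hL.trans hK) x
  nm_nm : ∀ {L K H : Subgroup G} (hL : L ≤ K) (hK : K ≤ H) (x : obj L),
    nm hK (nm hL x) = nm (hL.trans hK) x
  conj_conj : ∀ (g h : G) {H H' H'' : Subgroup G} (e₁ : conjSubgroup h H = H')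
    (e₂ : conjSubgroup g H' = H'') (e₃ : conjSubgroup (g * h) H = H'') (x : obj H),
    conj g e₂ (conj h e₁ x) = conj (g * h) e₃ x
  conj_inner : ∀ {H : Subgroup G} {h : G}, h ∈ H → ∀ (e : conjSubgroup h H = H) (x : obj H),
    conj h e x = x
  -- conjugacy compatibility
  conj_res : ∀ (g : G) {K H : Subgroup G} (hK : K ≤ H) (x : obj H),
    conj g rfl (res hK x) = res (Subgroup.map_mono hK) (conj g rfl x)
  conj_tr : ∀ (g : G) {K H : Subgroup G} (hK : K ≤ H) (x : obj K),
    conj g rfl (tr hK x) = tr (Subgroup.map_mono hK) (conj g rfl x)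
  conj_nm : ∀ (g : G) {K H : Subgroup G} (hK : K ≤ H) (x : obj K),
    conj g rfl (nm hK x) = nm (Subgroup.map_mono hK) (conj g rfl x)
  -- additive double coset formula
  res_tr : ∀ {H L K : Subgroup G} (hH : H ≤ K) (hL : L ≤ K) (R : Finset K),
    IsDoubleCosetReps L K H R → ∀ a : obj H,
    res hL (tr hH a) = ∑ γ ∈ R,
      tr (inf_le_left : L ⊓ conjSubgroup (γ : G) H ≤ L) (res inf_le_right (conj (γ : G) rfl a))
  -- multiplicative double coset formula
  res_nm : ∀ {H L K : Subgroup G} (hH : H ≤ K) (hL : L ≤ K) (R : Finset K),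
    IsDoubleCosetReps L K H R → ∀ a : obj H,
    res hL (nm hH a) = ∏ γ ∈ R,
      nm (inf_le_left : L ⊓ conjSubgroup (γ : G) H ≤ L) (res inf_le_right (conj (γ : G) rfl a))
  -- Frobenius reciprocity
  tr_res_mul : ∀ {K H : Subgroup G} (hK : K ≤ H) (x : obj H) (y : obj K),
    tr hK (res hK x * y) = x * tr hK y
  /-- Tambara reciprocity for sums: `N^K_H (a + b)` is the sum, over the `K`-orbits of
  functions `f : K / H → {a, b}`, of
  `t^K_S (∏_{[γ] ∈ S \ K / H} N^S_{S ∩ γHγ⁻¹} r^{γHγ⁻¹}_{S ∩ γHγ⁻¹} c_γ (f (γH)))`,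
  where `S` is the stabilizer of `f`. -/
  nm_add : ∀ {H K : Subgroup G} (hH : H ≤ K) (F : Finset (CosetsIn K H → Bool))
    (R : (CosetsIn K H → Bool) → Finset K), IsColouringReps F →
    (∀ f ∈ F, IsDoubleCosetReps (colouringStab f) K H (R f)) → ∀ a b : obj H,
    nm hH (a + b) = ∑ f ∈ F, tr (colouringStab_le f) (∏ γ ∈ R f,
      nm (inf_le_left : colouringStab f ⊓ conjSubgroup (γ : G) H ≤ colouringStab f)
        (res inf_le_right (conj (γ : G) rfl (bif f (γ : CosetsIn K H) then a else b))))
  /-- Tambara reciprocity for transfers: `N^K_H (t^H_L a)` is the sum, over the `K`-orbits of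
  sections `s` of `K / L → K / H`, of
  `t^K_S (∏_{[γ] ∈ S \ K / H} N^S_{S ∩ γHγ⁻¹} r^{γLγ⁻¹}_{S ∩ γHγ⁻¹} c_γ a)`,
  where `S` is the stabilizer of `s` and each representative `γ` is taken inside its coset `γH`
  such that `s (γH) = γL`; then `S ∩ γHγ⁻¹ = S ∩ γLγ⁻¹`. -/
  nm_tr : ∀ {L H K : Subgroup G} (hL : L ≤ H) (hH : H ≤ K)
    (F : Finset (CosetsIn K H → CosetsIn K L))
    (R : (CosetsIn K H → CosetsIn K L) → Finset K), IsSectionReps hL F →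
    (∀ s ∈ F, IsDoubleCosetReps (sectionStab s) K H (R s) ∧
      ∀ γ ∈ R s, s (γ : CosetsIn K H) = (γ : CosetsIn K L)) → ∀ a : obj L,
    nm hH (tr hL a) = ∑ s ∈ F, tr (sectionStab_le s) (∏ γ ∈ R s,
      nm (inf_le_left : sectionStab s ⊓ conjSubgroup (γ : G) L ≤ sectionStab s)
        (res inf_le_right (conj (γ : G) rfl a)))

attribute [instance] TambaraFunctor.ring

section Ideals

variable {G : Type u} [Group G]

/-- A Tambara ideal of `T`: a family of ideals `I(G/H) ⊆ T(G/H)` that is closed under restriction,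
transfer and norm, with `c_g (I(G/H)) = I(G/gHg⁻¹)`. -/
@[ext]
structure TambaraIdeal (T : TambaraFunctor.{u, v} G) where
  level : ∀ H : Subgroup G, Ideal (T.obj H)
  res_mem : ∀ {K H : Subgroup G} (h : K ≤ H) {x : T.obj H}, x ∈ level H → T.res h x ∈ level K
  tr_mem : ∀ {K H : Subgroup G} (h : K ≤ H) {x : T.obj K}, x ∈ level K → T.tr h x ∈ level H
  nm_mem : ∀ {K H : Subgroup G} (h : K ≤ H) {x : T.obj K}, x ∈ level K → T.nm h x ∈ level H
  conj_image : ∀ (g : G) (H : Subgroup G),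
    T.conj g rfl '' (level H : Set (T.obj H)) = level (conjSubgroup g H)

namespace TambaraIdeal

variable {T : TambaraFunctor.{u, v} G}

/-- Inclusion of Tambara ideals is levelwise inclusion. -/
instance : PartialOrder (TambaraIdeal T) :=
  PartialOrder.lift level fun _ _ h => TambaraIdeal.ext h

/-- `I` is proper if `1 ∉ I(G/G)`. -/
def IsProper (I : TambaraIdeal T) : Prop := (1 : T.obj ⊤) ∉ I.level ⊤

lemma conj_mem_iff (I : TambaraIdeal T) (g : G) (H : Subgroup G) (x : T.obj H) :
    T.conj g rfl x ∈ I.level (conjSubgroup g H) ↔ x ∈ I.level H := by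
  rw [← SetLike.mem_coe, ← I.conj_image g H, (T.conj g rfl).injective.mem_set_image,
    SetLike.mem_coe]

/-- The smallest Tambara ideal containing a family of subsets: the levelwise intersection of all
Tambara ideals that contain it. -/
def span (S : ∀ H : Subgroup G, Set (T.obj H)) : TambaraIdeal T where
  level H := ⨅ J ∈ {J : TambaraIdeal T | ∀ H, S H ⊆ J.level H}, J.level H
  res_mem h x hx := by
    simp only [Submodule.mem_iInf] at hx ⊢
    exact fun J hJ => J.res_mem h (hx J hJ)
  tr_mem h x hx := by
    simp only [Submodule.mem_iInf] at hx ⊢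
    exact fun J hJ => J.tr_mem h (hx J hJ)
  nm_mem h x hx := by
    simp only [Submodule.mem_iInf] at hx ⊢
    exact fun J hJ => J.nm_mem h (hx J hJ)
  conj_image g H := by
    ext y
    obtain ⟨x, rfl⟩ := (T.conj g (rfl : conjSubgroup g H = _)).surjective y
    rw [(T.conj g rfl).injective.mem_set_image]
    simp only [SetLike.mem_coe, Submodule.mem_iInf, conj_mem_iff]

/-- The unit ideal `T`. -/
def unit (T : TambaraFunctor.{u, v} G) : TambaraIdeal T where
  level _ := ⊤
  res_mem _ _ _ := Submodule.mem_top
  tr_mem _ _ _ := Submodule.mem_top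
  nm_mem _ _ _ := Submodule.mem_top
  conj_image g H := by
    simp [(T.conj g (rfl : conjSubgroup g H = _)).surjective.range_eq]

/-- The Tambara ideal `⟨x⟩` generated by one element `x ∈ T(G/H)`. -/
def principal {H : Subgroup G} (x : T.obj H) : TambaraIdeal T :=
  span fun K => {y | (⟨K, y⟩ : Σ L, T.obj L) = ⟨H, x⟩}

/-- The product `IJ`: the Tambara ideal generated by the levelwise products of ideals. -/
def prod (I J : TambaraIdeal T) : TambaraIdeal T :=
  span fun H => (I.level H * J.level H : Ideal (T.obj H))

/-- The `n`-fold product `Iⁿ` (the unit ideal for `n = 0`). -/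
def pow (I : TambaraIdeal T) : ℕ → TambaraIdeal T
  | 0 => unit T
  | n + 1 => prod (pow I n) I

/-- A Tambara ideal `P` is prime if it is proper and `IJ ⊆ P` implies `I ⊆ P` or `J ⊆ P`. -/
def IsPrime (P : TambaraIdeal T) : Prop :=
  P.IsProper ∧ ∀ I J : TambaraIdeal T, prod I J ≤ P → I ≤ P ∨ J ≤ P

/-- The level `(√I)(G/H) = {x ∈ T(G/H) | ⟨x⟩ⁿ ⊆ I for some n ≥ 1}` of the radical of `I`. -/
def radicalLevel (I : TambaraIdeal T) (H : Subgroup G) : Set (T.obj H) :=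
  {x | ∃ n : ℕ, 1 ≤ n ∧ pow (principal x) n ≤ I}

/-- `I` is radical if `I = √I`. -/
def IsRadical (I : TambaraIdeal T) : Prop :=
  ∀ H : Subgroup G, (I.level H : Set (T.obj H)) = I.radicalLevel H

end TambaraIdeal

/-- The set of radical Tambara ideals of `T`. -/
structure RadId (T : TambaraFunctor.{u, v} G) where
  ideal : TambaraIdeal T
  isRadical : ideal.IsRadical

/-- The Nakaoka spectrum: the set of prime Tambara ideals of `T`. -/
structure NakaokaSpec (T : TambaraFunctor.{u, v} G) where
  ideal : TambaraIdeal T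
  isPrime : ideal.IsPrime

/-- The topology for which the sets `V_H(x) = {P | x ∈ P(G/H)}` are a subbasis of closed sets. -/
instance (T : TambaraFunctor.{u, v} G) : TopologicalSpace (NakaokaSpec T) :=
  TopologicalSpace.generateFrom
    {U | ∃ (H : Subgroup G) (x : T.obj H), U = {P : NakaokaSpec T | x ∈ P.ideal.level H}ᶜ}

end Ideals

/-! Every open set of the Nakaoka spectrum has the form `{P | ¬ I ≤ P}`: the subbasic ones come from
principal ideals, finite intersections from products (by primality), unions from generated ideals
(`exists_eq_setOf_not_le`). An ideal `I` and the intersection of the primes above it give the same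
open set, so the theorem reduces to Krull's statement that `√I` is this intersection
(`mem_radicalLevel_iff`).

Krull's argument takes `P ⊇ I` maximal among the ideals containing no power of `⟨x⟩` and shows that
`P` is prime. It needs `⟨x⟩ⁿ` to be compact, for Zorn's lemma, and products to be associative, for
`⟨x⟩^(m+n) ≤ ⟨x⟩^m ⟨x⟩^n`. Both follow from an explicit form of generated ideals: if a family is
closed under multiples, restrictions, norms and conjugations, then the sums of transfers of its
elements form a Tambara ideal. Closure under norms (`nm_mem_trClosure`) is where Tambara reciprocity
enters. Such ideals multiply elementwise (`prod_toTambaraIdeal`), and since `G` is finite, `⟨x⟩`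
arises from finitely many generators at each level. -/

/-- For an equivalence relation on a finite type, there is a system of representatives having a
given property, one for each class that has a member with that property. -/
lemma exists_finset_representatives {α : Type*} [Finite α] (r : Setoid α) (p : α → Prop) :
    ∃ R : Finset α, (∀ b ∈ R, p b) ∧
      ∀ a, (∃ b, r b a ∧ p b) → ∃! b, b ∈ R ∧ r b a := by
  classical
  have := Fintype.ofFinite α
  let c : α → α := fun a =>
    if h : ∃ b, r b a ∧ p b then h.choose else a
  have hc : ∀ a, (∃ b, r b a ∧ p b) → r (c a) a ∧ p (c a) := fun a h => by
    simp only [c, dif_pos h]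
    exact h.choose_spec
  have hcc : ∀ a b, r a b → (∃ d, r d a ∧ p d) → c a = c b := fun a b hab h => by
    -- Equivalent elements satisfy literally equal existence statements, so `choose` picks the same
    -- witness for both.
    have e : (fun d => r d a ∧ p d) = fun d => r d b ∧ p d := by
      funext d
      exact propext (and_congr_left fun _ =>
        ⟨fun h => r.trans' h hab, fun h => r.trans' h (r.symm' hab)⟩)
    have h' : ∃ d, r d b ∧ p d := by
      obtain ⟨d, hd⟩ := h
      exact ⟨d, (congrFun e d).mp hd⟩
    simp only [c, dif_pos h, dif_pos h']
    congr 1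
  refine ⟨(Finset.univ.filter fun a => ∃ b, r b a ∧ p b).image c, ?_, fun a ha => ?_⟩
  · intro b hb
    obtain ⟨a, ha, rfl⟩ := Finset.mem_image.mp hb
    exact (hc a (Finset.mem_filter.mp ha).2).2
  · refine ⟨c a, ⟨Finset.mem_image_of_mem c (by simpa using ha), (hc a ha).1⟩, ?_⟩
    rintro b ⟨hb, hba⟩
    obtain ⟨a', ha', rfl⟩ := Finset.mem_image.mp hb
    have h' := (Finset.mem_filter.mp ha').2
    exact hcc a' a (r.trans' (r.symm' (hc a' h').1) hba) h'

/-! ### Existence of orbit and double coset representatives -/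

section Representatives

variable {G : Type u} [Group G]

/-- The equivalence relation on `K` whose classes are the traces of the double cosets `L k H`. -/
def doubleCosetSetoid (L K H : Subgroup G) : Setoid K where
  r γ k := ∃ l ∈ L, ∃ h ∈ H, (γ : G) = l * k * h
  iseqv :=
    { refl := fun k => ⟨1, L.one_mem, 1, H.one_mem, by simp⟩
      symm := by
        rintro a b ⟨l, hl, h, hh, e⟩
        exact ⟨l⁻¹, L.inv_mem hl, h⁻¹, H.inv_mem hh, by rw [e]; group⟩
      trans := by
        rintro a b c ⟨l, hl, h, hh, e⟩ ⟨l', hl', h', hh', e'⟩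
        exact ⟨l * l', L.mul_mem hl hl', h' * h, H.mul_mem hh' hh, by rw [e, e']; group⟩ }

/-- The side condition `p` serves Tambara reciprocity for transfers, where representatives must
satisfy `s (γH) = γL`. -/
lemma exists_isDoubleCosetReps_of [Finite G] (L K H : Subgroup G) (p : K → Prop)
    (hp : ∀ k : K, ∃ γ : K, (∃ l ∈ L, ∃ h ∈ H, (γ : G) = l * k * h) ∧ p γ) :
    ∃ R : Finset K, IsDoubleCosetReps L K H R ∧ ∀ γ ∈ R, p γ := by
  obtain ⟨R, h, h'⟩ := exists_finset_representatives (doubleCosetSetoid L K H) p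
  exact ⟨R, fun k => h' k (hp k), h⟩

lemma exists_isDoubleCosetReps [Finite G] (L K H : Subgroup G) :
    ∃ R : Finset K, IsDoubleCosetReps L K H R := by
  obtain ⟨R, h, -⟩ := exists_isDoubleCosetReps_of L K H (fun _ => True) fun k =>
    ⟨k, (doubleCosetSetoid L K H).refl' k, trivial⟩
  exact ⟨R, h⟩

lemma IsDoubleCosetReps.nonempty {L K H : Subgroup G} {R : Finset K}
    (hR : IsDoubleCosetReps L K H R) : R.Nonempty :=
  let ⟨γ, hγ, _⟩ := hR 1
  ⟨γ, hγ.1⟩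

lemma exists_isColouringReps [Finite G] (K H : Subgroup G) :
    ∃ F : Finset (CosetsIn K H → Bool), IsColouringReps F := by
  let r : Setoid (CosetsIn K H → Bool) :=
    { r := fun f' f => ∃ k : K, ∀ x, f' x = f (k⁻¹ • x)
      iseqv :=
        { refl := fun f => ⟨1, by simp⟩
          symm := by
            rintro f f' ⟨k, hk⟩
            exact ⟨k⁻¹, fun x => by rw [hk]; simp⟩
          trans := by
            rintro f f' f'' ⟨k, hk⟩ ⟨l, hl⟩
            exact ⟨k * l, fun x => by rw [hk, hl, mul_inv_rev, mul_smul]⟩ } }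
  obtain ⟨F, -, h⟩ := exists_finset_representatives r fun _ => True
  exact ⟨F, fun f => h f ⟨f, r.refl' f, trivial⟩⟩

lemma exists_isSectionReps [Finite G] {L H : Subgroup G} (K : Subgroup G) (hL : L ≤ H) :
    ∃ F : Finset (CosetsIn K H → CosetsIn K L), IsSectionReps hL F := by
  let r : Setoid (CosetsIn K H → CosetsIn K L) :=
    { r := fun s' s => ∃ k : K, ∀ x, s' x = k • s (k⁻¹ • x)
      iseqv :=
        { refl := fun s => ⟨1, by simp⟩
          symm := by
            rintro s s' ⟨k, hk⟩
            exact ⟨k⁻¹, fun x => by rw [hk]; simp⟩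
          trans := by
            rintro s s' s'' ⟨k, hk⟩ ⟨l, hl⟩
            exact ⟨k * l, fun x => by rw [hk, hl, mul_inv_rev, mul_smul, mul_smul]⟩ } }
  obtain ⟨F, h, h'⟩ := exists_finset_representatives r (IsCosetSection hL)
  exact ⟨F, h, fun s hs => h' s ⟨s, r.refl' s, hs⟩⟩

lemma exists_isDoubleCosetReps_section [Finite G] {L H K : Subgroup G} (hL : L ≤ H)
    {s : CosetsIn K H → CosetsIn K L} (hs : IsCosetSection hL s) (S : Subgroup G) :
    ∃ R : Finset K, IsDoubleCosetReps S K H R ∧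
      ∀ γ ∈ R, s (γ : CosetsIn K H) = (γ : CosetsIn K L) := by
  refine exists_isDoubleCosetReps_of S K H _ fun k => ?_
  obtain ⟨γ, hγ⟩ := QuotientGroup.mk_surjective (s (k : CosetsIn K H))
  -- As `s` is a section, a representative `γ` of `s (kH)` stays in `kH`, hence in the double coset
  -- of `k`.
  have h : (γ : CosetsIn K H) = (k : CosetsIn K H) := by
    have := hs (k : CosetsIn K H)
    rw [← hγ] at this
    exact this
  refine ⟨γ, ⟨1, S.one_mem, (k : G)⁻¹ * γ, ?_, by simp⟩, ?_⟩
  · exact Subgroup.mem_subgroupOf.mp (QuotientGroup.eq.mp h.symm)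
  · rw [h, hγ]

/-- `K` acts transitively on `K / H`, so a colouring fixed by all of `K` is constant. This separates
the terms of `N(a + b)` that allow induction on the target group from those built from `N(a)` and
`N(b)`. -/
lemma colouringStab_lt_or_const {K H : Subgroup G} (f : CosetsIn K H → Bool) :
    colouringStab f < K ∨ ∃ b, ∀ x, f x = b := by
  refine or_iff_not_imp_left.mpr fun h => ⟨f ((1 : K) : CosetsIn K H), fun x => ?_⟩
  have hK : K ≤ colouringStab f := by
    by_contra h'
    exact h (lt_of_le_not_ge (colouringStab_le f) h')
  obtain ⟨k, rfl⟩ := QuotientGroup.mk_surjective x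
  obtain ⟨_, hk⟩ := hK k.2
  have := hk ((1 : K) : CosetsIn K H)
  rw [← this, MulAction.Quotient.smul_coe]
  simp

end Representatives

/-! ### Tambara ideals, primes and multiplicative ideals -/

section Ideals

variable {G : Type u} [Group G] {T : TambaraFunctor.{u, v} G}

lemma TambaraFunctor.conj_conj_inv (T : TambaraFunctor.{u, v} G) (g : G) {H H' : Subgroup G}
    (e : conjSubgroup g H = H') (e' : conjSubgroup g⁻¹ H' = H) (x : T.obj H') :
    T.conj g e (T.conj g⁻¹ e' x) = x := by
  have h : conjSubgroup (g * g⁻¹) H' = H' := by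
    ext; simp [conjSubgroup]
  rw [T.conj_conj g g⁻¹ e' e h, T.conj_inner (by simp)]

lemma conjSubgroup_inv_conjSubgroup (g : G) (H : Subgroup G) :
    conjSubgroup g⁻¹ (conjSubgroup g H) = H := by
  rw [conjSubgroup, conjSubgroup, Subgroup.map_map]
  ext
  simp [mul_assoc]

/-- A family of subsets of the values of a Tambara functor that is closed under multiplication by
arbitrary elements, restriction, norm and conjugation (but not under addition or transfer). -/
structure MulIdeal (T : TambaraFunctor.{u, v} G) where
  carrier : ∀ H : Subgroup G, Set (T.obj H)
  zero_mem : ∀ H, 0 ∈ carrier H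
  mul_mem : ∀ {H} (c : T.obj H) {x : T.obj H}, x ∈ carrier H → c * x ∈ carrier H
  res_mem : ∀ {K H : Subgroup G} (h : K ≤ H) {x : T.obj H}, x ∈ carrier H → T.res h x ∈ carrier K
  nm_mem : ∀ {K H : Subgroup G} (h : K ≤ H) {x : T.obj K}, x ∈ carrier K → T.nm h x ∈ carrier H
  conj_mem : ∀ (g : G) {H H' : Subgroup G} (e : conjSubgroup g H = H') {x : T.obj H},
    x ∈ carrier H → T.conj g e x ∈ carrier H'

namespace TambaraIdeal

lemma le_def {I J : TambaraIdeal T} : I ≤ J ↔ ∀ H, ∀ x ∈ I.level H, x ∈ J.level H := Iff.rfl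

lemma span_le {S : ∀ H : Subgroup G, Set (T.obj H)} {J : TambaraIdeal T} :
    span S ≤ J ↔ ∀ H, S H ⊆ J.level H := by
  refine ⟨fun h H x hx => h H ?_, fun h H x hx => ?_⟩
  · simp only [span, Submodule.mem_iInf]
    exact fun J hJ => hJ H hx
  · simp only [span, Submodule.mem_iInf] at hx
    exact hx J h

lemma principal_le {H : Subgroup G} {x : T.obj H} {J : TambaraIdeal T} :
    principal x ≤ J ↔ x ∈ J.level H := by
  rw [principal, span_le]
  refine ⟨fun h => h H rfl, ?_⟩
  intro h K y hy
  cases hy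
  exact h

lemma prod_le {I J P : TambaraIdeal T} :
    prod I J ≤ P ↔ ∀ H, ∀ a ∈ I.level H, ∀ b ∈ J.level H, a * b ∈ P.level H := by
  rw [prod, span_le]
  exact forall_congr' fun H => Ideal.mul_le

lemma mul_mem_prod {I J : TambaraIdeal T} {H : Subgroup G} {a b : T.obj H}
    (ha : a ∈ I.level H) (hb : b ∈ J.level H) : a * b ∈ (prod I J).level H :=
  prod_le.mp le_rfl H a ha b hb

lemma prod_mono {I I' J J' : TambaraIdeal T} (h : I ≤ I') (h' : J ≤ J') :
    prod I J ≤ prod I' J' :=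
  prod_le.mpr fun H _ ha _ hb => mul_mem_prod (h H ha) (h' H hb)

lemma prod_le_left (I J : TambaraIdeal T) : prod I J ≤ I :=
  prod_le.mpr fun H _ ha b _ => (I.level H).mul_mem_right b ha

lemma prod_le_right (I J : TambaraIdeal T) : prod I J ≤ J :=
  prod_le.mpr fun H a _ _ hb => (J.level H).mul_mem_left a hb

lemma conj_mem (I : TambaraIdeal T) (g : G) {H H' : Subgroup G} (e : conjSubgroup g H = H')
    {x : T.obj H} (hx : x ∈ I.level H) : T.conj g e x ∈ I.level H' := by
  subst e
  exact (I.conj_mem_iff g H x).mpr hx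

lemma IsProper.not_unit_le {I : TambaraIdeal T} (h : I.IsProper) : ¬ unit T ≤ I :=
  fun h' => h (h' ⊤ Submodule.mem_top)

lemma isProper_of_not_unit_le {I : TambaraIdeal T} (h : ¬ unit T ≤ I) : I.IsProper := by
  intro h1
  refine h fun H x _ => ?_
  have := I.res_mem (le_top : H ≤ ⊤) h1
  rw [map_one] at this
  exact (Ideal.eq_top_iff_one _).mpr this ▸ Submodule.mem_top

lemma IsPrime.prod_le_iff {P : TambaraIdeal T} (hP : P.IsPrime) {I J : TambaraIdeal T} :
    prod I J ≤ P ↔ I ≤ P ∨ J ≤ P :=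
  ⟨hP.2 I J, fun h => h.elim (prod_le_left I J).trans (prod_le_right I J).trans⟩

lemma IsPrime.le_of_pow_le {P : TambaraIdeal T} (hP : P.IsPrime) {I : TambaraIdeal T} :
    ∀ {n : ℕ}, pow I n ≤ P → I ≤ P
  | 0, h => absurd h hP.1.not_unit_le
  | _ + 1, h => (hP.2 _ _ h).elim hP.le_of_pow_le id

/-- The intersection of the primes containing `I`, as a Tambara ideal. -/
def radical (I : TambaraIdeal T) : TambaraIdeal T where
  level H := ⨅ P ∈ {P : TambaraIdeal T | P.IsPrime ∧ I ≤ P}, P.level H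
  res_mem h x hx := by
    simp only [Submodule.mem_iInf] at hx ⊢
    exact fun P hP => P.res_mem h (hx P hP)
  tr_mem h x hx := by
    simp only [Submodule.mem_iInf] at hx ⊢
    exact fun P hP => P.tr_mem h (hx P hP)
  nm_mem h x hx := by
    simp only [Submodule.mem_iInf] at hx ⊢
    exact fun P hP => P.nm_mem h (hx P hP)
  conj_image g H := by
    ext y
    obtain ⟨x, rfl⟩ := (T.conj g (rfl : conjSubgroup g H = _)).surjective y
    rw [(T.conj g rfl).injective.mem_set_image]
    simp only [SetLike.mem_coe, Submodule.mem_iInf, conj_mem_iff]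

lemma mem_radical {I : TambaraIdeal T} {H : Subgroup G} {x : T.obj H} :
    x ∈ I.radical.level H ↔ ∀ P : TambaraIdeal T, P.IsPrime → I ≤ P → x ∈ P.level H := by
  simp only [radical, Submodule.mem_iInf, Set.mem_ofPred_eq, and_imp]

lemma IsPrime.radical_le_iff {P : TambaraIdeal T} (hP : P.IsPrime) {I : TambaraIdeal T} :
    I.radical ≤ P ↔ I ≤ P :=
  ⟨fun h H _ hx => h H (mem_radical.mpr fun _ _ hIQ => hIQ H hx),
    fun h _ _ hx => mem_radical.mp hx P hP h⟩

end TambaraIdeal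

/-! ### Tambara ideals as sums of transfers -/

namespace MulIdeal

/-- The multiplicative ideal underlying a Tambara ideal. -/
def ofTambaraIdeal (I : TambaraIdeal T) : MulIdeal T where
  carrier H := I.level H
  zero_mem H := (I.level H).zero_mem
  mul_mem c _ hx := Ideal.mul_mem_left _ c hx
  res_mem := I.res_mem
  nm_mem := I.nm_mem
  conj_mem := I.conj_mem

/-- The products of elements of two multiplicative ideals. -/
def mul (S S' : MulIdeal T) : MulIdeal T where
  carrier H := {z | ∃ a ∈ S.carrier H, ∃ b ∈ S'.carrier H, a * b = z}
  zero_mem H := ⟨0, S.zero_mem H, 0, S'.zero_mem H, mul_zero 0⟩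
  mul_mem := by
    rintro H c _ ⟨a, ha, b, hb, rfl⟩
    exact ⟨c * a, S.mul_mem c ha, b, hb, mul_assoc c a b⟩
  res_mem := by
    rintro K H h _ ⟨a, ha, b, hb, rfl⟩
    exact ⟨_, S.res_mem h ha, _, S'.res_mem h hb, (map_mul _ a b).symm⟩
  nm_mem := by
    rintro K H h _ ⟨a, ha, b, hb, rfl⟩
    exact ⟨_, S.nm_mem h ha, _, S'.nm_mem h hb, (map_mul _ a b).symm⟩
  conj_mem := by
    rintro g H H' e _ ⟨a, ha, b, hb, rfl⟩
    exact ⟨_, S.conj_mem g e ha, _, S'.conj_mem g e hb, (map_mul _ a b).symm⟩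

/-- The union of a nonempty set of Tambara ideals. -/
def iUnion (c : Set (TambaraIdeal T)) (hc : c.Nonempty) : MulIdeal T where
  carrier H := {x | ∃ J ∈ c, x ∈ J.level H}
  zero_mem H := let ⟨J, hJ⟩ := hc; ⟨J, hJ, (J.level H).zero_mem⟩
  mul_mem := by
    rintro H a x ⟨J, hJ, hx⟩
    exact ⟨J, hJ, Ideal.mul_mem_left _ a hx⟩
  res_mem := by
    rintro K H h x ⟨J, hJ, hx⟩
    exact ⟨J, hJ, J.res_mem h hx⟩
  nm_mem := by
    rintro K H h x ⟨J, hJ, hx⟩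
    exact ⟨J, hJ, J.nm_mem h hx⟩
  conj_mem := by
    rintro g H H' e x ⟨J, hJ, hx⟩
    exact ⟨J, hJ, J.conj_mem g e hx⟩

variable (S S' : MulIdeal T)

lemma mem_of_dvd {H : Subgroup G} {x y : T.obj H} (hx : x ∈ S.carrier H) (h : x ∣ y) :
    y ∈ S.carrier H := by
  obtain ⟨c, rfl⟩ := h
  rw [mul_comm]
  exact S.mul_mem c hx

/-- The sums of transfers of elements of a multiplicative ideal. -/
def trClosure (H : Subgroup G) : AddSubmonoid (T.obj H) :=
  AddSubmonoid.closure {y | ∃ (K : Subgroup G) (h : K ≤ H), ∃ x ∈ S.carrier K, T.tr h x = y}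

variable {S} in
lemma tr_mem_trClosure' {K H : Subgroup G} (h : K ≤ H) {x : T.obj K} (hx : x ∈ S.carrier K) :
    T.tr h x ∈ S.trClosure H :=
  AddSubmonoid.subset_closure ⟨K, h, x, hx, rfl⟩

variable {S} in
lemma mem_trClosure {H : Subgroup G} {x : T.obj H} (hx : x ∈ S.carrier H) :
    x ∈ S.trClosure H := by
  rw [← T.tr_refl x]
  exact tr_mem_trClosure' le_rfl hx

variable {S} in
/-- An additive map sends `S.trClosure H` into an additive submonoid if it sends the transfers of
elements of `S` there. -/
lemma map_mem_of_mem_trClosure {H : Subgroup G} {M : Type*} [AddCommMonoid M]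
    {F : Type*} [FunLike F (T.obj H) M] [AddMonoidHomClass F (T.obj H) M] (φ : F)
    {N : AddSubmonoid M}
    (hφ : ∀ (K : Subgroup G) (h : K ≤ H), ∀ x ∈ S.carrier K, φ (T.tr h x) ∈ N)
    {x : T.obj H} (hx : x ∈ S.trClosure H) : φ x ∈ N := by
  induction hx using AddSubmonoid.closure_induction with
  | mem y hy => obtain ⟨K, h, x, hx, rfl⟩ := hy; exact hφ K h x hx
  | zero => rw [map_zero]; exact N.zero_mem
  | add a b _ _ ha hb => rw [map_add]; exact N.add_mem ha hb

lemma mul_mem_trClosure {H : Subgroup G} (c : T.obj H) {x : T.obj H}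
    (hx : x ∈ S.trClosure H) : c * x ∈ S.trClosure H := by
  refine map_mem_of_mem_trClosure (AddMonoidHom.mulLeft c) (fun K h x hx => ?_) hx
  rw [AddMonoidHom.coe_mulLeft, ← T.tr_res_mul]
  exact tr_mem_trClosure' h (S.mul_mem _ hx)

lemma mem_trClosure_of_dvd {H : Subgroup G} {x y : T.obj H} (hx : x ∈ S.trClosure H)
    (h : x ∣ y) : y ∈ S.trClosure H := by
  obtain ⟨c, rfl⟩ := h
  rw [mul_comm]
  exact S.mul_mem_trClosure c hx

lemma tr_mem_trClosure {K H : Subgroup G} (h : K ≤ H) {x : T.obj K}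
    (hx : x ∈ S.trClosure K) : T.tr h x ∈ S.trClosure H := by
  refine map_mem_of_mem_trClosure (T.tr h) (fun L h' x hx => ?_) hx
  rw [T.tr_tr]
  exact tr_mem_trClosure' _ hx

lemma conj_mem_trClosure (g : G) {H H' : Subgroup G} (e : conjSubgroup g H = H') {x : T.obj H}
    (hx : x ∈ S.trClosure H) : T.conj g e x ∈ S.trClosure H' := by
  subst e
  refine map_mem_of_mem_trClosure (T.conj g rfl) (fun L h' x hx => ?_) hx
  rw [T.conj_tr]
  exact tr_mem_trClosure' _ (S.conj_mem g rfl hx)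

/-- A multiplicative ideal is finitely generated if at each level it consists of the multiples of
finitely many elements. -/
def FG (S : MulIdeal T) : Prop :=
  ∃ A : ∀ H, Set (T.obj H), (∀ H, (A H).Finite) ∧ ∀ H, S.carrier H = {y | ∃ a ∈ A H, a ∣ y}

lemma FG.mul {S S' : MulIdeal T} (h : S.FG) (h' : S'.FG) : (S.mul S').FG := by
  obtain ⟨A, hA, e⟩ := h
  obtain ⟨B, hB, e'⟩ := h'
  refine ⟨fun H => Set.image2 (· * ·) (A H) (B H), fun H => (hA H).image2 _ (hB H), fun H => ?_⟩
  ext z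
  constructor
  · rintro ⟨x, hx, y, hy, rfl⟩
    rw [e] at hx
    rw [e'] at hy
    obtain ⟨a, ha, hax⟩ := hx
    obtain ⟨b, hb, hby⟩ := hy
    exact ⟨a * b, ⟨a, ha, b, hb, rfl⟩, mul_dvd_mul hax hby⟩
  · rintro ⟨_, ⟨a, ha, b, hb, rfl⟩, h⟩
    refine (S.mul S').mem_of_dvd ⟨a, ?_, b, ?_, rfl⟩ h
    · rw [e]; exact ⟨a, ha, dvd_rfl⟩
    · rw [e']; exact ⟨b, hb, dvd_rfl⟩

variable [Finite G]

lemma res_mem_trClosure {K H : Subgroup G} (h : K ≤ H) {x : T.obj H}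
    (hx : x ∈ S.trClosure H) : T.res h x ∈ S.trClosure K := by
  refine map_mem_of_mem_trClosure (T.res h) (fun L h' x hx => ?_) hx
  obtain ⟨R, hR⟩ := exists_isDoubleCosetReps K H L
  rw [T.res_tr h' h R hR]
  exact AddSubmonoid.sum_mem _ fun γ _ =>
    tr_mem_trClosure' _ (S.res_mem _ (S.conj_mem _ rfl hx))

/-- The norm of a transfer of an element of `S` is a sum of transfers of elements of `S`. -/
lemma nm_tr_mem_trClosure {L H K : Subgroup G} (hL : L ≤ H) (hH : H ≤ K) {x : T.obj L}
    (hx : x ∈ S.carrier L) : T.nm hH (T.tr hL x) ∈ S.trClosure K := by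
  classical
  obtain ⟨F, hF⟩ := exists_isSectionReps K hL
  choose! R hR using fun s (hs : s ∈ F) =>
    exists_isDoubleCosetReps_section hL (hF.1 s hs) (sectionStab s)
  rw [T.nm_tr hL hH F R hF hR]
  refine AddSubmonoid.sum_mem _ fun s hs => tr_mem_trClosure' _ ?_
  -- The product is nonempty and `S` absorbs multiplication, so one factor in `S` suffices.
  obtain ⟨γ, hγ⟩ := (hR s hs).1.nonempty
  exact S.mem_of_dvd (S.nm_mem _ (S.res_mem _ (S.conj_mem _ rfl hx)))
    (Finset.dvd_prod_of_mem _ hγ)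

/-- Double induction: on the target `K`, for all sources at once, and on the length of the sum.
Tambara reciprocity writes `N(a + b)` as a sum of transfers from stabilizers. A proper stabilizer
falls under the outer induction, a constant colouring under the inner one. -/
lemma nm_mem_trClosure {H K : Subgroup G} (hH : H ≤ K) {x : T.obj H}
    (hx : x ∈ S.trClosure H) : T.nm hH x ∈ S.trClosure K := by
  induction K using WellFoundedLT.induction generalizing H with
  | ind K ih =>
  induction hx using AddSubmonoid.closure_induction with
  | mem y hy =>
    obtain ⟨L, hL, x, hx, rfl⟩ := hy
    exact S.nm_tr_mem_trClosure hL hH hx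
  -- `N(0) = 0` is not an axiom; closure of `S` under norms replaces it.
  | zero => exact mem_trClosure (S.nm_mem hH (S.zero_mem H))
  | add a b ha' hb' ha hb =>
    obtain ⟨F, hF⟩ := exists_isColouringReps K H
    choose R hR using fun f : CosetsIn K H → Bool =>
      exists_isDoubleCosetReps (colouringStab f) K H
    rw [T.nm_add hH F R hF fun f _ => hR f]
    refine AddSubmonoid.sum_mem _ fun f _ => S.tr_mem_trClosure _ ?_
    rcases colouringStab_lt_or_const f with h | ⟨c, hc⟩
    · obtain ⟨γ, hγ⟩ := (hR f).nonempty
      refine S.mem_trClosure_of_dvd (ih _ h _ ?_) (Finset.dvd_prod_of_mem _ hγ)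
      refine S.res_mem_trClosure _ (S.conj_mem_trClosure _ rfl ?_)
      cases f γ
      exacts [hb', ha']
    · simp only [hc]
      -- For a constant colouring the product is the restriction of `N(a)` or `N(b)` to the
      -- stabilizer, so the stabilizer need not be identified with `K`.
      rw [← T.res_nm hH (colouringStab_le f) (R f) (hR f)]
      refine S.res_mem_trClosure _ ?_
      cases c
      exacts [hb, ha]

/-- The Tambara ideal generated by a multiplicative ideal. -/
def toTambaraIdeal : TambaraIdeal T where
  level H := { S.trClosure H with smul_mem' := fun c _ hx => S.mul_mem_trClosure c hx }
  res_mem h _ hx := S.res_mem_trClosure h hx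
  tr_mem h _ hx := S.tr_mem_trClosure h hx
  nm_mem h _ hx := S.nm_mem_trClosure h hx
  conj_image g H := by
    refine Set.Subset.antisymm ?_ fun y hy => ?_
    · rintro _ ⟨x, hx, rfl⟩
      exact S.conj_mem_trClosure g rfl hx
    · exact ⟨T.conj g⁻¹ (conjSubgroup_inv_conjSubgroup g H) y, S.conj_mem_trClosure _ _ hy,
        T.conj_conj_inv g _ _ y⟩

variable {S S'}

lemma mem_toTambaraIdeal {H : Subgroup G} {x : T.obj H} :
    x ∈ S.toTambaraIdeal.level H ↔ x ∈ S.trClosure H := Iff.rfl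

lemma toTambaraIdeal_le {J : TambaraIdeal T} :
    S.toTambaraIdeal ≤ J ↔ ∀ H, S.carrier H ⊆ J.level H := by
  refine ⟨fun h H x hx => h H (mem_trClosure hx), fun h H x hx => ?_⟩
  exact map_mem_of_mem_trClosure (AddMonoidHom.id _) (N := (J.level H).toAddSubmonoid)
    (fun K hK y hy => J.tr_mem hK (h K hy)) hx

/-- By Frobenius reciprocity and the double coset formula, the product of the Tambara ideals
generated by two multiplicative ideals is generated by the elementwise products. -/
lemma prod_toTambaraIdeal (S S' : MulIdeal T) :
    TambaraIdeal.prod S.toTambaraIdeal S'.toTambaraIdeal = (S.mul S').toTambaraIdeal := by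
  apply le_antisymm
  · refine TambaraIdeal.prod_le.mpr fun H a ha b hb => ?_
    refine map_mem_of_mem_trClosure (AddMonoidHom.mulRight b) (fun K hK x hx => ?_) ha
    -- `tr x * b = tr (x * res b)`; then `res b` is itself a sum of transfers `tr y`, and `x * tr y
    -- = tr (res x * y)`.
    rw [AddMonoidHom.mulRight_apply, mul_comm, ← T.tr_res_mul, mul_comm]
    refine (S.mul S').tr_mem_trClosure hK ?_
    refine map_mem_of_mem_trClosure (AddMonoidHom.mulLeft x) (fun L hL y hy => ?_)
      (S'.res_mem_trClosure hK hb)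
    rw [AddMonoidHom.coe_mulLeft, ← T.tr_res_mul]
    exact tr_mem_trClosure' hL ⟨_, S.res_mem hL hx, y, hy, rfl⟩
  · rw [toTambaraIdeal_le]
    rintro H _ ⟨a, ha, b, hb, rfl⟩
    exact TambaraIdeal.mul_mem_prod (mem_trClosure ha) (mem_trClosure hb)

lemma toTambaraIdeal_ofTambaraIdeal (I : TambaraIdeal T) :
    (ofTambaraIdeal I).toTambaraIdeal = I :=
  le_antisymm (toTambaraIdeal_le.mpr fun _ _ h => h) fun _ _ h => mem_trClosure h

/-- The norms of restrictions of conjugates of `x`. -/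
def normSet {H : Subgroup G} (x : T.obj H) (K : Subgroup G) : Set (T.obj K) :=
  {y | ∃ (L : Subgroup G) (h : L ≤ K) (g : G) (H' : Subgroup G) (e : conjSubgroup g H = H')
    (h' : L ≤ H'), T.nm h (T.res h' (T.conj g e x)) = y}

lemma finite_normSet {H : Subgroup G} (x : T.obj H) (K : Subgroup G) : (normSet x K).Finite := by
  have : normSet x K = Set.range fun i : Σ' (L : Subgroup G) (_ : L ≤ K) (g : G) (H' : Subgroup G)
      (_ : conjSubgroup g H = H'), L ≤ H' =>
      T.nm i.2.1 (T.res i.2.2.2.2.2 (T.conj _ i.2.2.2.2.1 x)) := by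
    ext y
    constructor
    · rintro ⟨L, h, g, H', e, h', rfl⟩
      exact ⟨⟨L, h, g, H', e, h'⟩, rfl⟩
    · rintro ⟨⟨L, h, g, H', e, h'⟩, rfl⟩
      exact ⟨L, h, g, H', e, h', rfl⟩
  rw [this]
  exact Set.finite_range _

/-- The multiples of norms of restrictions of conjugates of `x`. -/
def principal {H : Subgroup G} (x : T.obj H) : MulIdeal T where
  carrier K := {y | ∃ a ∈ normSet x K, a ∣ y}
  zero_mem K := ⟨_, ⟨⊥, bot_le, 1, _, rfl, bot_le, rfl⟩, dvd_zero _⟩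
  mul_mem := by
    rintro K c y ⟨a, ha, hy⟩
    exact ⟨a, ha, hy.mul_left c⟩
  res_mem := by
    rintro M K h y ⟨_, ⟨L, hL, g, H', e, h', rfl⟩, hy⟩
    obtain ⟨R, hR⟩ := exists_isDoubleCosetReps M K L
    obtain ⟨γ, hγ⟩ := hR.nonempty
    -- By the multiplicative double coset formula the restricted norm is a product of elements of
    -- `normSet`; any one of them divides it.
    refine ⟨_, ?_, (Finset.dvd_prod_of_mem _ hγ).trans
      ((T.res_nm hL h R hR _).symm.dvd.trans (map_dvd (T.res h) hy))⟩
    refine ⟨_, inf_le_left, γ * g, conjSubgroup γ H', ?_,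
      inf_le_right.trans (Subgroup.map_mono h'), ?_⟩
    · subst e
      simp only [conjSubgroup, Subgroup.map_map]
      congr 1
      ext; simp
    · rw [T.conj_res, T.res_res, T.conj_conj]
  nm_mem := by
    rintro K M h y ⟨_, ⟨L, hL, g, H', e, h', rfl⟩, hy⟩
    exact ⟨_, ⟨L, hL.trans h, g, H', e, h', (T.nm_nm hL h _).symm⟩, map_dvd (T.nm h) hy⟩
  conj_mem := by
    rintro k K _ rfl y ⟨_, ⟨L, hL, g, H', e, h', rfl⟩, hy⟩
    refine ⟨_, ⟨_, Subgroup.map_mono hL, k * g, conjSubgroup k H', ?_, Subgroup.map_mono h', ?_⟩,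
      map_dvd (T.conj k rfl) hy⟩
    · subst e
      simp only [conjSubgroup, Subgroup.map_map]
      congr 1
      ext; simp
    · rw [T.conj_nm, T.conj_res, T.conj_conj]

lemma fg_principal {H : Subgroup G} (x : T.obj H) : (principal x).FG :=
  ⟨normSet x, finite_normSet x, fun _ => rfl⟩

lemma toTambaraIdeal_principal {H : Subgroup G} (x : T.obj H) :
    (principal x).toTambaraIdeal = TambaraIdeal.principal x := by
  apply le_antisymm
  · rw [toTambaraIdeal_le]
    rintro K y ⟨_, ⟨L, hL, g, H', e, h', rfl⟩, hy⟩
    have hx : x ∈ (TambaraIdeal.principal x).level H := TambaraIdeal.principal_le.mp le_rfl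
    exact Ideal.mem_of_dvd _ hy
      (TambaraIdeal.nm_mem _ _ (TambaraIdeal.res_mem _ _ (TambaraIdeal.conj_mem _ g e hx)))
  · rw [TambaraIdeal.principal_le]
    have e : conjSubgroup 1 H = H := by ext; simp [conjSubgroup]
    refine mem_trClosure ⟨_, ⟨H, le_rfl, 1, H, e, le_rfl, rfl⟩, ?_⟩
    rw [T.nm_refl, T.res_refl, T.conj_inner H.one_mem]

end MulIdeal

/-! ### Powers, compactness and Krull's theorem -/

namespace TambaraIdeal

variable [Finite G]

/-- Products of ideals are generated by the elementwise products, whose associativity is that of the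
rings. -/
lemma prod_assoc (I J K : TambaraIdeal T) : prod (prod I J) K = prod I (prod J K) := by
  rw [← MulIdeal.toTambaraIdeal_ofTambaraIdeal I, ← MulIdeal.toTambaraIdeal_ofTambaraIdeal J,
    ← MulIdeal.toTambaraIdeal_ofTambaraIdeal K]
  simp only [MulIdeal.prod_toTambaraIdeal]
  congr 1
  simp only [MulIdeal.mul, MulIdeal.mk.injEq]
  funext H
  ext z
  constructor
  · rintro ⟨_, ⟨a, ha, b, hb, rfl⟩, c, hc, rfl⟩
    exact ⟨a, ha, _, ⟨b, hb, c, hc, rfl⟩, (mul_assoc a b c).symm⟩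
  · rintro ⟨a, ha, _, ⟨b, hb, c, hc, rfl⟩, rfl⟩
    exact ⟨_, ⟨a, ha, b, hb, rfl⟩, c, hc, mul_assoc a b c⟩

lemma pow_add_le (I : TambaraIdeal T) (m n : ℕ) : pow I (m + n) ≤ prod (pow I m) (pow I n) := by
  induction n with
  | zero =>
    intro H x hx
    rw [← mul_one x]
    exact mul_mem_prod hx Submodule.mem_top
  | succ n ih =>
    rw [← add_assoc, pow, pow, ← prod_assoc]
    exact prod_mono ih le_rfl

lemma exists_fg_pow_principal {H : Subgroup G} (x : T.obj H) (n : ℕ) :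
    ∃ S : MulIdeal T, S.FG ∧ S.toTambaraIdeal = pow (principal x) n := by
  induction n with
  | zero =>
    exact ⟨.ofTambaraIdeal (unit T),
      ⟨fun _ => {1}, fun _ => Set.finite_singleton 1, fun _ => by
        ext; simp [MulIdeal.ofTambaraIdeal, unit]⟩,
      MulIdeal.toTambaraIdeal_ofTambaraIdeal _⟩
  | succ n ih =>
    obtain ⟨S, hS, e⟩ := ih
    exact ⟨S.mul (.principal x), hS.mul (MulIdeal.fg_principal x), by
      rw [← MulIdeal.prod_toTambaraIdeal, e, MulIdeal.toTambaraIdeal_principal, pow]⟩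

/-- The union of a chain is already closed under sums and transfers, so generating an ideal from it
adds nothing. -/
lemma exists_mem_chain {c : Set (TambaraIdeal T)} (hc : c.Nonempty) (hch : IsChain (· ≤ ·) c)
    {H : Subgroup G} {x : T.obj H} (hx : x ∈ (MulIdeal.iUnion c hc).toTambaraIdeal.level H) :
    ∃ J ∈ c, x ∈ J.level H := by
  rw [MulIdeal.mem_toTambaraIdeal] at hx
  induction hx using AddSubmonoid.closure_induction with
  | mem y hy =>
    obtain ⟨K, h, x, ⟨J, hJ, hx⟩, rfl⟩ := hy
    exact ⟨J, hJ, J.tr_mem h hx⟩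
  | zero => exact let ⟨J, hJ⟩ := hc; ⟨J, hJ, (J.level H).zero_mem⟩
  | add a b _ _ ha hb =>
    obtain ⟨J, hJ, ha⟩ := ha
    obtain ⟨J', hJ', hb⟩ := hb
    obtain h | h := hch.total hJ hJ'
    · exact ⟨J', hJ', Ideal.add_mem _ (h H ha) hb⟩
    · exact ⟨J, hJ, Ideal.add_mem _ ha (h H hb)⟩

/-- Finitely generated multiplicative ideals generate compact Tambara ideals. -/
lemma exists_le_of_le_chain {c : Set (TambaraIdeal T)} (hc : c.Nonempty)
    (hch : IsChain (· ≤ ·) c) {S : MulIdeal T} (hS : S.FG)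
    (h : S.toTambaraIdeal ≤ (MulIdeal.iUnion c hc).toTambaraIdeal) :
    ∃ J ∈ c, S.toTambaraIdeal ≤ J := by
  obtain ⟨A, hA, e⟩ := hS
  have := fun H => (hA H).to_subtype
  have key : ∀ i : Σ H, A H, ∃ J ∈ c, i.2.1 ∈ J.level i.1 := fun i => by
    refine exists_mem_chain hc hch (MulIdeal.toTambaraIdeal_le.mp h i.1 ?_)
    rw [e]
    exact ⟨_, i.2.2, dvd_rfl⟩
  choose J hJ hJ' using key
  obtain ⟨M, hM, hMJ⟩ : ∃ M ∈ c, ∀ i, J i ≤ M := by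
    have : Nonempty c := hc.to_subtype
    obtain ⟨M, hM⟩ := (directedOn_iff_directed.mp hch.directedOn).finite_le
      fun i => (⟨J i, hJ i⟩ : c)
    exact ⟨M, M.2, hM⟩
  refine ⟨M, hM, MulIdeal.toTambaraIdeal_le.mpr fun H y hy => ?_⟩
  rw [e] at hy
  obtain ⟨a, ha, hy⟩ := hy
  exact Ideal.mem_of_dvd _ hy (hMJ ⟨H, a, ha⟩ H (hJ' ⟨H, a, ha⟩))

/-- An element all of whose powers avoid `I` is avoided by a prime containing `I`. -/
lemma exists_isPrime_of_forall_not_pow_le {I : TambaraIdeal T} {H : Subgroup G} {x : T.obj H}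
    (hI : ∀ n, ¬ pow (principal x) n ≤ I) : ∃ P : TambaraIdeal T, P.IsPrime ∧ I ≤ P ∧
      x ∉ P.level H := by
  obtain ⟨P, hIP, hP⟩ := zorn_le_nonempty₀
    -- The exponent `0` is included: avoiding the unit ideal makes the maximal element proper.
    {J : TambaraIdeal T | ∀ n, ¬ pow (principal x) n ≤ J} (fun c hc hch J hJ => by
      refine ⟨(MulIdeal.iUnion c ⟨J, hJ⟩).toTambaraIdeal, fun n hn => ?_,
        fun J' hJ' K y hy => MulIdeal.mem_trClosure ⟨J', hJ', hy⟩⟩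
      obtain ⟨S, hS, e⟩ := exists_fg_pow_principal x n
      obtain ⟨J', hJ', h⟩ := exists_le_of_le_chain ⟨J, hJ⟩ hch hS (e.trans_le hn)
      exact hc hJ' n (e.symm.trans_le h)) I hI
  refine ⟨P, ⟨isProper_of_not_unit_le (hP.prop 0), fun A B hAB => ?_⟩, hIP, fun hx => ?_⟩
  · by_contra! hcon
    -- The ideal generated by `A ∪ P` strictly contains `P`, so by maximality it contains a power of
    -- `⟨x⟩`.
    have key : ∀ {A : TambaraIdeal T}, ¬ A ≤ P → ∃ n, pow (principal x) n ≤
        (MulIdeal.iUnion {A, P} (Set.insert_nonempty _ _)).toTambaraIdeal := fun {A} hA => by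
      by_contra! h
      refine hA fun K y hy => hP.le_of_ge h ?_ K ?_
      · exact fun K y hy => MulIdeal.mem_trClosure ⟨P, by simp, hy⟩
      · exact MulIdeal.mem_trClosure ⟨A, by simp, hy⟩
    obtain ⟨m, hm⟩ := key hcon.1
    obtain ⟨n, hn⟩ := key hcon.2
    -- `⟨x⟩^(m+n) ≤ (A + P)(B + P) ≤ P`, since every elementwise product lies in `AB` or in `P`.
    refine hP.prop (m + n) ((pow_add_le _ m n).trans ((prod_mono hm hn).trans ?_))
    rw [MulIdeal.prod_toTambaraIdeal, MulIdeal.toTambaraIdeal_le]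
    rintro K _ ⟨a, ⟨J, hJ, ha⟩, b, ⟨J', hJ', hb⟩, rfl⟩
    obtain rfl | rfl := hJ
    · obtain rfl | rfl := hJ'
      · exact prod_le.mp hAB K a ha b hb
      · exact Ideal.mul_mem_left _ a hb
    · exact Ideal.mul_mem_right b _ ha
  · exact hP.prop 1 ((prod_le_right _ _).trans (principal_le.mpr hx))

lemma mem_radicalLevel_iff {I : TambaraIdeal T} {H : Subgroup G} {x : T.obj H} :
    x ∈ I.radicalLevel H ↔ ∀ P : TambaraIdeal T, P.IsPrime → I ≤ P → x ∈ P.level H := by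
  constructor
  · rintro ⟨n, -, hn⟩ P hP hIP
    exact principal_le.mp (hP.le_of_pow_le (hn.trans hIP))
  · intro h
    by_contra hx
    obtain ⟨P, hP, hIP, hxP⟩ := exists_isPrime_of_forall_not_pow_le (I := I) (x := x) fun n hn =>
      -- The radical requires a positive exponent; raising `n` by one covers `n = 0`.
      hx ⟨n + 1, by omega, (prod_le_left _ _).trans hn⟩
    exact hxP (h P hP hIP)

lemma isRadical_iff {I : TambaraIdeal T} : I.IsRadical ↔
    ∀ H, ∀ x : T.obj H, (∀ P : TambaraIdeal T, P.IsPrime → I ≤ P → x ∈ P.level H) →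
      x ∈ I.level H := by
  refine forall_congr' fun H => ?_
  rw [Set.ext_iff]
  refine forall_congr' fun x => ?_
  rw [mem_radicalLevel_iff]
  exact ⟨fun h => h.mpr, fun h => ⟨fun hx P _ hIP => hIP H hx, h⟩⟩

lemma isRadical_radical (I : TambaraIdeal T) : I.radical.IsRadical :=
  isRadical_iff.mpr fun _ _ hx => mem_radical.mpr fun P hP hIP =>
    hx P hP (hP.radical_le_iff.mpr hIP)

lemma IsRadical.le_iff {I J : TambaraIdeal T} (hJ : J.IsRadical) :
    I ≤ J ↔ ∀ P : TambaraIdeal T, P.IsPrime → J ≤ P → I ≤ P :=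
  ⟨fun h _ _ hJP => h.trans hJP, fun h H x hx =>
    isRadical_iff.mp hJ H x fun P hP hJP => h P hP hJP H hx⟩

end TambaraIdeal

/-! ### Open sets of the spectrum and the frame isomorphism -/

namespace NakaokaSpec

open TambaraIdeal

lemma isOpen_setOf_not_le (I : TambaraIdeal T) :
    IsOpen {P : NakaokaSpec T | ¬ I ≤ P.ideal} := by
  have : {P : NakaokaSpec T | ¬ I ≤ P.ideal} =
      ⋃ (H : Subgroup G) (x ∈ I.level H), {P : NakaokaSpec T | x ∈ P.ideal.level H}ᶜ := by
    ext P
    simp [le_def]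
  rw [this]
  exact isOpen_iUnion fun H => isOpen_iUnion fun x => isOpen_iUnion fun _ =>
    TopologicalSpace.isOpen_generateFrom_of_mem ⟨H, x, rfl⟩

lemma exists_eq_setOf_not_le {U : Set (NakaokaSpec T)} (hU : IsOpen U) :
    ∃ I : TambaraIdeal T, U = {P | ¬ I ≤ P.ideal} := by
  induction hU with
  | basic U hU =>
    obtain ⟨H, x, rfl⟩ := hU
    exact ⟨principal x, by ext; simp [principal_le]⟩
  | univ => exact ⟨unit T, by ext P; simpa using P.isPrime.1.not_unit_le⟩
  | inter U V _ _ hU hV =>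
    obtain ⟨I, rfl⟩ := hU
    obtain ⟨J, rfl⟩ := hV
    exact ⟨prod I J, by ext P; simp [P.isPrime.prod_le_iff]⟩
  | sUnion 𝒰 _ h =>
    have : Nonempty (TambaraIdeal T) := ⟨unit T⟩
    choose! I hI using h
    refine ⟨span fun H => ⋃ U ∈ 𝒰, (I U).level H, ?_⟩
    ext P
    simp only [Set.mem_sUnion, Set.mem_ofPred_eq, span_le, Set.iUnion_subset_iff, not_forall]
    constructor
    · rintro ⟨U, hU, hP⟩
      rw [hI U hU] at hP
      by_contra! h
      exact hP fun H => h H U hU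
    · rintro ⟨H, U, hU, h⟩
      refine ⟨U, hU, ?_⟩
      rw [hI U hU]
      exact fun hle => h (hle H)

end NakaokaSpec

namespace RadId

variable [Finite G]

/-- The open set of primes that do not contain a given radical Tambara ideal. -/
def toOpens (I : RadId T) : TopologicalSpace.Opens (NakaokaSpec T) :=
  ⟨{P | ¬ I.ideal ≤ P.ideal}, NakaokaSpec.isOpen_setOf_not_le I.ideal⟩

lemma toOpens_le_iff {I J : RadId T} : I.toOpens ≤ J.toOpens ↔ I.ideal ≤ J.ideal := by
  refine Iff.trans ?_ J.isRadical.le_iff.symm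
  exact ⟨fun h P hP hJP => not_not.mp fun hIP => @h ⟨P, hP⟩ hIP hJP,
    fun h P hIP hJP => hIP (h P.ideal P.isPrime hJP)⟩

lemma toOpens_bijective :
    Function.Bijective (toOpens : RadId T → TopologicalSpace.Opens (NakaokaSpec T)) := by
  constructor
  · rintro ⟨I, hI⟩ ⟨J, hJ⟩ h
    obtain rfl : I = J := le_antisymm (toOpens_le_iff.mp h.le) (toOpens_le_iff.mp h.ge)
    rfl
  · intro U
    obtain ⟨I, hI⟩ := NakaokaSpec.exists_eq_setOf_not_le U.isOpen
    -- The same primes lie above `I` and above its radical.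
    refine ⟨⟨I.radical, I.isRadical_radical⟩, TopologicalSpace.Opens.ext ?_⟩
    rw [hI]
    ext P
    exact not_congr P.isPrime.radical_le_iff

end RadId

end Ideals

/-- Transfer a frame structure along an equivalence. -/
abbrev Equiv.orderFrame {α β : Type*} (e : α ≃ β) [Order.Frame β] : Order.Frame α :=
  letI : Max α := ⟨fun a b => e.symm (e a ⊔ e b)⟩
  letI : Min α := ⟨fun a b => e.symm (e a ⊓ e b)⟩
  letI : LE α := ⟨fun a b => e a ≤ e b⟩
  letI : LT α := ⟨fun a b => e a < e b⟩
  letI : SupSet α := ⟨fun s => e.symm (⨆ a ∈ s, e a)⟩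
  letI : InfSet α := ⟨fun s => e.symm (⨅ a ∈ s, e a)⟩
  letI : Top α := ⟨e.symm ⊤⟩
  letI : Bot α := ⟨e.symm ⊥⟩
  letI : Compl α := ⟨fun a => e.symm (e a)ᶜ⟩
  letI : HImp α := ⟨fun a b => e.symm (e a ⇨ e b)⟩
  Function.Injective.frame e e.injective Iff.rfl Iff.rfl (fun _ _ => e.apply_symm_apply _)
    (fun _ _ => e.apply_symm_apply _) (fun _ => e.apply_symm_apply _)
    (fun _ => e.apply_symm_apply _) (e.apply_symm_apply _) (e.apply_symm_apply _)
    (fun _ => e.apply_symm_apply _) (fun _ _ => e.apply_symm_apply _)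

theorem mainTheorem3 {G : Type u} [Group G] [Finite G] (T : TambaraFunctor.{u, v} G) :
    ∃ _ : Order.Frame (RadId T),
      (∀ I J : RadId T, I ≤ J ↔ I.ideal ≤ J.ideal) ∧
      ∃ e : Frm.of (RadId T) ≅ Frm.of (TopologicalSpace.Opens (NakaokaSpec T)),
        ∀ (I : RadId T) (P : NakaokaSpec T), P ∈ e.hom I ↔ ¬ I.ideal ≤ P.ideal := by
  let e : RadId T ≃ TopologicalSpace.Opens (NakaokaSpec T) :=
    Equiv.ofBijective RadId.toOpens RadId.toOpens_bijective
  let := e.orderFrame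
  -- The transported order is inclusion of open sets, which `toOpens_le_iff` identifies with
  -- inclusion of ideals.
  exact ⟨this, fun I J => RadId.toOpens_le_iff, Frm.Iso.mk ⟨e, Iff.rfl⟩, fun I P => Iff.rfl⟩
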